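/- For $x,y\ge 0$ let $$d_0(x,y)=\frac{1+2x}{1+x}+\frac{xy}{1+y+xy},\qquad d_2(x,y)=\frac{xy^2}{1+y+xy}\,\frac{1+x}{1+y},\qquad d_1(x,y)=-\frac{x}{1+x}-\frac{xy}{1+y+xy}-d_2(x,y),$$ and let $R_e\approx1.4877$ be the unique positive root of $d_1(R,0)+\tfrac7{10}\sqrt{R}\,d_2(R,R)=0$. For a mesh $0=t_0<t_1<\dots<t_N$ put $\tau_k=t_k-t_{k-1}$ $(1\le k\le N)$, $\tau=\max_{1\le k\le N}\tau_k$, $r_k=\tau_k/\tau_{k-1}$ $(2\le k\le N)$, $\partial_\tau v^n=(v^n-v^{n-1})/\tau_n$. For $n\ge3$ put $d^{(n)}_j=d_j(r_n,r_{n-1})$ for $j=0,1,2$, $d^{(n)}_j=0$ for $j\ge3$, and $$D_3v^n=d^{(n)}_0\,\partial_\tau v^n+d^{(n)}_1\,\partial_\tau v^{n-1}+d^{(n)}_2\,\partial_\tau v^{n-2}.$$ The discrete orthogonal convolution (DOC) kernels are defined, for $n\ge 3$, by $$\vartheta^{(n)}_0=\frac1{d^{(n)}_0},\qquad \vartheta^{(n)}_{n-j}=-\frac1{d^{(j)}_0}\sum_{i=j+1}^n\vartheta^{(n)}_{n-i}\,d^{(i)}_{i-j}\quad(3\le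 j\le n-1).$$ Theorem. There is an absolute constant $K_3>0$ (independent of the mesh, its step ratios, and all other data below) such that the following two statements hold. (a) For every mesh with $0<r_k\le R_e$ for $2\le k\le N$, and all $3\le n\le N$, $i\ge3$, $$\sum_{j=3}^n\bigl|\vartheta^{(n)}_{n-j}\bigr|\le K_3\quad\text{and}\quad \sum_{j=i}^n\bigl|\vartheta^{(j)}_{j-i}\bigr|\le K_3 .$$ (b) Let $\Omega\subset\mathbb R^d$ be a bounded convex open set (no regularity of $\partial\Omega$ is needed), $\varepsilon>0$ a constant, and $\kappa$ a smooth bounded function on $\Omega$ with $\kappa(x)<0$ for all $x\in\Omega$. Let a mesh satisfy $0<r_k<R_e$ for $2\le k\le N$. Let $f^k\in L^2(\Omega)$ $(3\le k\le N)$, let the starting values $u^0,u^1,u^2\in L^2(\Omega)$ be arbitrary, and let $u^k\in H^1_0(\Omega)$ $(3\le k\le N)$ be a weak solution of the BDF3 scheme with homogeneous Dirichlet boundary condition $$D_3u^k=\varepsilon\Delta u^k+\kappa u^k+f^k\quad\text{in }\Omega,\qquad 3\le k\le N.$$ Then, with $\|\cdot\|$ the $L^2(\Omega)$ norm, for all $3\le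 n\le N$, $$\begin{aligned}\|u^n\|&\le\|u^2\|+K_3\tau\|\partial_\tau u^1\|+4K_3\tau\|\partial_\tau u^2\|+2\sum_{k=3}^n\tau_k\sum_{j=3}^k\bigl|\vartheta^{(k)}_{k-j}\bigr|\,\|f^j\|\\&\le\|u^2\|+K_3\tau\|\partial_\tau u^1\|+4K_3\tau\|\partial_\tau u^2\|+2K_3t_n\max_{3\le k\le n}\|f^k\|.\end{aligned}$$ -/

import Mathlib

open MeasureTheory Filter Topology
open scoped ContDiff

noncomputable section

namespace BDF3

/-! ### Coefficients of the variable-step formula and the step-ratio limit -/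

def d0 (x y : ℝ) : ℝ := (1 + 2 * x) / (1 + x) + x * y / (1 + y + x * y)

def d1 (x y : ℝ) : ℝ :=
  -(x / (1 + x)) - x * y / (1 + y + x * y)
    - x * y ^ 2 / (1 + y + x * y) * ((1 + x) / (1 + y))

def d2 (x y : ℝ) : ℝ := x * y ^ 2 / (1 + y + x * y) * ((1 + x) / (1 + y))

/-- The function of `R` whose unique positive root is the step-ratio limit. -/
def ratioFun (R : ℝ) : ℝ := d1 R 0 + 7 / 10 * √R * d2 R R

theorem ratioFun_eq {R : ℝ} (hR : 0 < R) :
    ratioFun R = R * (7 / 10 * (√R * (R ^ 2 / (1 + R + R ^ 2))) - 1 / (1 + R)) := by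
  have h1 : (1 + R) ≠ 0 := by positivity
  have h2 : (1 + R + R ^ 2) ≠ 0 := by positivity
  have h3 : (1 + R + R * R) ≠ 0 := by positivity
  unfold ratioFun d1 d2
  rw [div_self h1]
  field_simp
  ring

theorem existsUnique_ratioFun_root : ∃! R : ℝ, 0 < R ∧ ratioFun R = 0 := by
  have hroot : ∃ R ∈ Set.Icc (1 : ℝ) 2, ratioFun R = 0 := by
    have hc : ContinuousOn ratioFun (Set.Icc (1 : ℝ) 2) := by
      have hc' : ContinuousOn
          (fun R : ℝ => R * (7 / 10 * (√R * (R ^ 2 / (1 + R + R ^ 2))) - 1 / (1 + R)))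
          (Set.Icc (1 : ℝ) 2) := by
        have ha : ∀ R ∈ Set.Icc (1 : ℝ) 2, 1 + R + R ^ 2 ≠ 0 := fun R hR => by
          have := hR.1
          positivity
        have hb : ∀ R ∈ Set.Icc (1 : ℝ) 2, 1 + R ≠ 0 := fun R hR => by
          have := hR.1
          positivity
        fun_prop (disch := assumption)
      exact hc'.congr fun R hR => ratioFun_eq (by linarith [hR.1])
    have h1 : ratioFun 1 ≤ 0 := by
      rw [ratioFun_eq one_pos, Real.sqrt_one]
      norm_num
    have h2 : 0 ≤ ratioFun 2 := by
      rw [ratioFun_eq two_pos]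
      have : (1 : ℝ) ≤ √2 := Real.one_le_sqrt.2 (by norm_num)
      norm_num
      linarith
    obtain ⟨R, hR, h⟩ := intermediate_value_Icc (by norm_num : (1 : ℝ) ≤ 2) hc ⟨h1, h2⟩
    exact ⟨R, hR, h⟩
  have hlt : ∀ a b : ℝ, 0 < a → a < b → ratioFun a = 0 → ratioFun b ≠ 0 := by
    intro a b ha hab h1 h2
    have hb : 0 < b := ha.trans hab
    rw [ratioFun_eq ha, mul_eq_zero, or_iff_right ha.ne'] at h1
    rw [ratioFun_eq hb, mul_eq_zero, or_iff_right hb.ne'] at h2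
    have e1 : 1 / (1 + b) < 1 / (1 + a) :=
      one_div_lt_one_div_of_lt (by linarith) (by linarith)
    have e2 : √a ≤ √b := Real.sqrt_le_sqrt hab.le
    have e3 : a ^ 2 / (1 + a + a ^ 2) ≤ b ^ 2 / (1 + b + b ^ 2) := by
      rw [div_le_div_iff₀ (by positivity) (by positivity)]
      nlinarith [mul_pos ha hb, mul_pos (mul_pos ha hb) (sub_pos.2 hab)]
    have e4 : √a * (a ^ 2 / (1 + a + a ^ 2)) ≤ √b * (b ^ 2 / (1 + b + b ^ 2)) :=
      mul_le_mul e2 e3 (by positivity) (Real.sqrt_nonneg b)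
    linarith
  obtain ⟨R, hR, h⟩ := hroot
  have hR0 : 0 < R := by linarith [hR.1]
  refine ⟨R, ⟨hR0, h⟩, ?_⟩
  rintro S ⟨hS, hS'⟩
  rcases lt_trichotomy S R with hl | hl | hl
  · exact absurd h (hlt S R hS hl hS')
  · exact hl
  · exact absurd hS' (hlt R S hR0 hl h)

/-- The step-ratio limit `R_e ≈ 1.4877`: the unique positive root of
`d₁(R, 0) + (7/10) √R d₂(R, R) = 0`. -/
def Re : ℝ := existsUnique_ratioFun_root.choose

theorem Re_pos : 0 < Re := existsUnique_ratioFun_root.choose_spec.1.1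

theorem ratioFun_Re : ratioFun Re = 0 := existsUnique_ratioFun_root.choose_spec.1.2

/-! ### Time meshes, difference quotients, kernels -/

/-- `0 = t 0 < t 1 < ⋯ < t N`; the values `t k` with `k > N` play no role. -/
def IsTimeMesh (t : ℕ → ℝ) (N : ℕ) : Prop :=
  t 0 = 0 ∧ ∀ k < N, t k < t (k + 1)

/-- The step `τ_k = t_k - t_{k-1}` (used for `k ≥ 1`). -/
def step (t : ℕ → ℝ) (k : ℕ) : ℝ := t k - t (k - 1)

/-- The step ratio `r_k = τ_k / τ_{k-1}` (used for `k ≥ 2`). -/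
def ratio (t : ℕ → ℝ) (k : ℕ) : ℝ := step t k / step t (k - 1)

/-- The maximum step `τ = max_{1 ≤ k ≤ N} τ_k`. -/
def maxStep (t : ℕ → ℝ) (N : ℕ) (hN : 1 ≤ N) : ℝ :=
  (Finset.Icc 1 N).sup' (Finset.nonempty_Icc.2 hN) (step t)

/-- The difference quotient `∂_τ v^n = (v^n - v^{n-1}) / τ_n` (used for `n ≥ 1`). -/
def diffQuot {V : Type*} [AddCommGroup V] [Module ℝ V] (t : ℕ → ℝ) (v : ℕ → V) (n : ℕ) : V :=
  (step t n)⁻¹ • (v n - v (n - 1))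

/-- The BDF3 kernels `d^{(n)}_j` (used for `n ≥ 3`). -/
def kernel (t : ℕ → ℝ) (n : ℕ) : ℕ → ℝ
  | 0 => d0 (ratio t n) (ratio t (n - 1))
  | 1 => d1 (ratio t n) (ratio t (n - 1))
  | 2 => d2 (ratio t n) (ratio t (n - 1))
  | _ => 0

/-- The variable-step BDF3 formula `D₃ v^n` (used for `n ≥ 3`). -/
def D3 {V : Type*} [AddCommGroup V] [Module ℝ V] (t : ℕ → ℝ) (v : ℕ → V) (n : ℕ) : V :=
  d0 (ratio t n) (ratio t (n - 1)) • diffQuot t v n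
    + d1 (ratio t n) (ratio t (n - 1)) • diffQuot t v (n - 1)
    + d2 (ratio t n) (ratio t (n - 1)) • diffQuot t v (n - 2)

/-- The discrete orthogonal convolution kernels: `doc t n m` is `θ^{(n)}_m`, defined by recursion
on the lower index `m = n - j` (used for `3 ≤ j ≤ n`). In the sum, `l = n - i` with
`j + 1 ≤ i ≤ n`; see `doc_sub` for the usual form. -/
def doc (t : ℕ → ℝ) (n : ℕ) : ℕ → ℝ
  | 0 => 1 / kernel t n 0
  | m + 1 => -(1 / kernel t (n - (m + 1)) 0) *
      ∑ l : Fin (m + 1), doc t n l * kernel t (n - l) (m + 1 - l)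

theorem doc_zero (t : ℕ → ℝ) (n : ℕ) : doc t n 0 = 1 / kernel t n 0 := by
  rw [doc]

theorem doc_sub (t : ℕ → ℝ) {n j : ℕ} (hj : j < n) :
    doc t n (n - j) = -(1 / kernel t j 0) *
      ∑ i ∈ Finset.Icc (j + 1) n, doc t n (n - i) * kernel t i (i - j) := by
  obtain ⟨m, rfl⟩ : ∃ m, n = j + (m + 1) := ⟨n - j - 1, by omega⟩
  have h1 : j + (m + 1) - j = m + 1 := by omega
  have h2 : j + (m + 1) - (m + 1) = j := by omega
  rw [h1, doc, h2]
  congr 1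
  rw [Fin.sum_univ_eq_sum_range
    (fun l => doc t (j + (m + 1)) l * kernel t (j + (m + 1) - l) (m + 1 - l)) (m + 1)]
  refine Finset.sum_bij' (fun l _ => j + (m + 1) - l) (fun i _ => j + (m + 1) - i) ?_ ?_ ?_ ?_ ?_
  · intro l hl
    simp only [Finset.mem_range, Finset.mem_Icc] at *
    omega
  · intro i hi
    simp only [Finset.mem_range, Finset.mem_Icc] at *
    omega
  · intro l hl
    simp only [Finset.mem_range] at *
    omega
  · intro i hi
    simp only [Finset.mem_Icc] at *
    omega
  · intro l hl
    simp only [Finset.mem_range] at hl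
    congr 2 <;> omega

/-! ### Function spaces and the time-discrete Dirichlet problem -/

/-- `L²(Ω)` for `Ω ⊆ ℝᵈ`, with its norm `‖·‖`. -/
abbrev L2 {d : ℕ} (Ω : Set (EuclideanSpace ℝ (Fin d))) : Type :=
  Lp ℝ 2 (volume.restrict Ω)

/-- `L²(Ω; ℝᵈ)`. -/
abbrev L2Vec {d : ℕ} (Ω : Set (EuclideanSpace ℝ (Fin d))) : Type :=
  Lp (EuclideanSpace ℝ (Fin d)) 2 (volume.restrict Ω)

/-- `φ ∈ C_c^∞(Ω)`. -/
def IsTest {d : ℕ} (Ω : Set (EuclideanSpace ℝ (Fin d)))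
    (φ : EuclideanSpace ℝ (Fin d) → ℝ) : Prop :=
  ContDiff ℝ ∞ φ ∧ HasCompactSupport φ ∧ tsupport φ ⊆ Ω

/-- `g = ∇u` in the weak sense on `Ω`. -/
def HasWeakGradient {d : ℕ} {Ω : Set (EuclideanSpace ℝ (Fin d))} (u : L2 Ω) (g : L2Vec Ω) : Prop :=
  ∀ φ, IsTest Ω φ → ∫ x in Ω, u x • gradient φ x = -∫ x in Ω, φ x • g x

/-- `u ∈ H¹₀(Ω)` with `∇u = g`: `u` has weak gradient `g`, and `u` is a limit of functions of
`C_c^∞(Ω)` in the `H¹(Ω)` norm. -/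
def HasH10Gradient {d : ℕ} {Ω : Set (EuclideanSpace ℝ (Fin d))} (u : L2 Ω) (g : L2Vec Ω) : Prop :=
  HasWeakGradient u g ∧
    ∃ φ : ℕ → EuclideanSpace ℝ (Fin d) → ℝ, (∀ m, IsTest Ω (φ m)) ∧
      Tendsto (fun m => eLpNorm (fun x => φ m x - u x) 2 (volume.restrict Ω)) atTop (𝓝 0) ∧
      Tendsto (fun m => eLpNorm (fun x => gradient (φ m) x - g x) 2 (volume.restrict Ω))
        atTop (𝓝 0)

/-- `u` is a (weak) solution of the BDF3 scheme: for `3 ≤ k ≤ N`, `u^k ∈ H¹₀(Ω)` and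
`D₃ u^k = ε Δ u^k + κ u^k + f^k` in `Ω`. The starting values `u^0, u^1, u^2` are arbitrary elements
of `L²(Ω)`. -/
def IsSolution {d : ℕ} {Ω : Set (EuclideanSpace ℝ (Fin d))} (ε : ℝ)
    (κ : EuclideanSpace ℝ (Fin d) → ℝ) (t : ℕ → ℝ) (N : ℕ) (f u : ℕ → L2 Ω) : Prop :=
  ∀ k, 3 ≤ k → k ≤ N → ∃ g : L2Vec Ω, HasH10Gradient (u k) g ∧
    ∀ φ, IsTest Ω φ →
      ∫ x in Ω, (D3 t u k) x * φ x =
        -(ε * ∫ x in Ω, inner ℝ (g x) (gradient φ x))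
          + ∫ x in Ω, (κ x * u k x + f k x) * φ x

end BDF3

end

noncomputable section

namespace BDF3

/-! Only the bound `Re < 3 / 2` is used: every coefficient estimate is proved on the square `[0,
3/2]²`, where it becomes a polynomial inequality.

Decay. The BDF3 kernels have three terms, so the DOC kernels satisfy a three-term recurrence. For
the rescaled quantities `w m = doc t n m * kernel t (n - m) 0` it reads `w (m+1) = a * w m - b * w
(m-1)` with `0 ≤ a ≤ 87/100` and `0 ≤ b ≤ 7/20`. One quadratic form contracts by the factor
`(19/20)²` for all such `a, b` (`lyapunov_le`). Hence `|doc t n m|` decays geometrically, and row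
and column sums are at most `22`.

Positivity. Writing `x = D v`, with `D` the BDF3 convolution and vanishing starting values, turns
the step-weighted DOC quadratic form of `x` into the sum of `step t k * ⟪(D v) k, v k⟫`. Each
summand dominates the increment of a nonnegative energy (`quadForm_nonneg`), so the sum is
nonnegative (`sum_doc_inner_nonneg`).

Stability. Convolving the scheme with the DOC kernels isolates the difference quotient of `u` at
level `k`, plus two starting terms. Testing with `2 * step t k` times `u k` makes diffusion and
reaction into minus two such nonnegative forms, one in the gradients and one in `√(-κ) u`. What
remains is a discrete inequality for `‖u k‖²`, linearized by looking at the largest norm. -/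

theorem Re_lt : Re < 3 / 2 := by
  by_contra! h
  have hR := Re_pos
  have h1 := ratioFun_Re
  rw [ratioFun_eq hR, mul_eq_zero, or_iff_right hR.ne'] at h1
  -- If `Re ≥ 3/2`, the factor vanishing at `Re` would be at least `7/10 * (61/50) * (9/19) - 2/5 >
  -- 0`.
  have e1 : 1 / (1 + Re) ≤ 1 / (1 + 3 / 2) := one_div_le_one_div_of_le (by norm_num) (by linarith)
  have e2 : (61 / 50 : ℝ) ≤ √Re := Real.le_sqrt_of_sq_le (by linarith)
  have e3 : (9 / 19 : ℝ) ≤ Re ^ 2 / (1 + Re + Re ^ 2) := by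
    rw [div_le_div_iff₀ (by norm_num) (by positivity)]
    nlinarith
  have e4 : (61 / 50 : ℝ) * (9 / 19) ≤ √Re * (Re ^ 2 / (1 + Re + Re ^ 2)) :=
    mul_le_mul e2 e3 (by positivity) (Real.sqrt_nonneg Re)
  linarith

/-! ### Coefficient bounds on the square `[0, 3/2]²` -/

section Coefficients

variable {x y : ℝ}

theorem d0_ge_one (hx : 0 ≤ x) (hy : 0 ≤ y) : 1 ≤ d0 x y := by
  unfold d0
  have : 1 ≤ (1 + 2 * x) / (1 + x) := by
    rw [le_div_iff₀ (by positivity)]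
    linarith
  have : 0 ≤ x * y / (1 + y + x * y) := by positivity
  linarith

theorem d2_nonneg (hx : 0 ≤ x) (hy : 0 ≤ y) : 0 ≤ d2 x y := by
  unfold d2
  positivity

theorem d1_nonpos (hx : 0 ≤ x) (hy : 0 ≤ y) : d1 x y ≤ 0 := by
  have h := d2_nonneg hx hy
  unfold d2 at h
  unfold d1
  have : 0 ≤ x / (1 + x) := by positivity
  have : 0 ≤ x * y / (1 + y + x * y) := by positivity
  linarith

theorem d0_le (hx : 0 ≤ x) (hy : 0 ≤ y) (hx' : x ≤ 3 / 2) (hy' : y ≤ 3 / 2) :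
    d0 x y ≤ 21 / 10 := by
  unfold d0
  have h1 : (1 + 2 * x) / (1 + x) ≤ 8 / 5 := by
    rw [div_le_iff₀ (by positivity)]
    linarith
  have h2 : x * y / (1 + y + x * y) ≤ 9 / 19 := by
    rw [div_le_iff₀ (by positivity)]
    nlinarith
  linarith

/-- The constant lies just above the value of `d2 / d0` at the corner `x = y = 3/2`, about `0.343`.
-/
theorem d2_le_mul_d0 (hx : 0 ≤ x) (hy : 0 ≤ y) (hx' : x ≤ 3 / 2) (hy' : y ≤ 3 / 2) :
    d2 x y ≤ 7 / 20 * d0 x y := by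
  have hX : 0 < 1 + x := by linarith
  have hY : 0 < 1 + y := by linarith
  have hQ : 0 < 1 + y + x * y := by positivity
  rw [← sub_nonneg]
  have : 7 / 20 * d0 x y - d2 x y =
      (7 / 20 * ((1 + 2 * x) * (1 + y + x * y) + x * y * (1 + x)) * (1 + y)
        - x * y ^ 2 * (1 + x) ^ 2) / ((1 + x) * (1 + y + x * y) * (1 + y)) := by
    unfold d0 d2
    field_simp
  rw [this]
  refine div_nonneg ?_ (by positivity)
  -- Bernstein form: since `(2/3) * (x + a) = (2/3) * (y + b) = 1`, the numerator can be homogenized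
  -- in `(x, a)` and `(y, b)`. All coefficients turn out positive. The next two lemmas use the same
  -- device.
  obtain ⟨a, ha⟩ : ∃ a, a = 3 / 2 - x := ⟨_, rfl⟩
  obtain ⟨b, hb⟩ : ∃ b, b = 3 / 2 - y := ⟨_, rfl⟩
  have ha0 : 0 ≤ a := by linarith
  have hb0 : 0 ≤ b := by linarith
  have key : 7 / 20 * ((1 + 2 * x) * (1 + y + x * y) + x * y * (1 + x)) * (1 + y)
      - x * y ^ 2 * (1 + x) ^ 2 = (2 / 3) ^ 5 / 320 * (
      a ^ 3 * (112 * b ^ 2 + 560 * y * b + 700 * y ^ 2)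
      + x * a ^ 2 * (672 * b ^ 2 + 3864 * y * b + 4380 * y ^ 2)
      + x ^ 2 * a * (1008 * b ^ 2 + 7182 * y * b + 6255 * y ^ 2)
      + x ^ 3 * (448 * b ^ 2 + 3878 * y * b + 145 * y ^ 2)) := by
    rw [ha, hb]
    ring
  rw [key]
  positivity

/-- At the corner `x = y = 3/2` the ratio `-d1 / d0` is about `0.860`. -/
theorem neg_d1_le_mul_d0 (hx : 0 ≤ x) (hy : 0 ≤ y) (hx' : x ≤ 3 / 2) (hy' : y ≤ 3 / 2) :
    -d1 x y ≤ 87 / 100 * d0 x y := by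
  have hX : 0 < 1 + x := by linarith
  have hY : 0 < 1 + y := by linarith
  have hQ : 0 < 1 + y + x * y := by positivity
  rw [← sub_nonneg]
  have : 87 / 100 * d0 x y - -d1 x y =
      ((87 / 100 * ((1 + 2 * x) * (1 + y + x * y) + x * y * (1 + x))
        - x * (1 + y + x * y) - x * y * (1 + x)) * (1 + y)
        - x * y ^ 2 * (1 + x) ^ 2) / ((1 + x) * (1 + y + x * y) * (1 + y)) := by
    unfold d0 d1
    field_simp
    ring
  rw [this]
  refine div_nonneg ?_ (by positivity)
  obtain ⟨a, ha⟩ : ∃ a, a = 3 / 2 - x := ⟨_, rfl⟩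
  obtain ⟨b, hb⟩ : ∃ b, b = 3 / 2 - y := ⟨_, rfl⟩
  have ha0 : 0 ≤ a := by linarith
  have hb0 : 0 ≤ b := by linarith
  have key : (87 / 100 * ((1 + 2 * x) * (1 + y + x * y) + x * y * (1 + x))
      - x * (1 + y + x * y) - x * y * (1 + x)) * (1 + y) - x * y ^ 2 * (1 + x) ^ 2 = (2 / 3) ^ 5 / 1600 * (
      a ^ 3 * (1392 * b ^ 2 + 6960 * y * b + 8700 * y ^ 2)
      + x * a ^ 2 * (5952 * b ^ 2 + 32424 * y * b + 38460 * y ^ 2)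
      + x ^ 2 * a * (7728 * b ^ 2 + 47262 * y * b + 42855 * y ^ 2)
      + x ^ 3 * (3168 * b ^ 2 + 21798 * y * b + 945 * y ^ 2)) := by
    rw [ha, hb]
    ring
  rw [key]
  positivity

/-- The discriminant condition behind the positivity of the BDF3 quadratic form. -/
theorem discriminant_nonneg (hx : 0 ≤ x) (hy : 0 ≤ y) (hx' : x ≤ 3 / 2) (hy' : y ≤ 3 / 2) :
    (d1 x y + 2 / 3 + y * d2 x y) ^ 2 ≤
      4 / 3 * (2 - y) * (1 / (1 + x) + y / (1 + y + x * y) - 3 / 4 * y * d2 x y ^ 2) := by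
  have hX : 0 < 1 + x := by linarith
  have hY : 0 < 1 + y := by linarith
  have hQ : 0 < 1 + y + x * y := by positivity
  rw [← sub_nonneg]
  have e1 : 1 / (1 + x) + y / (1 + y + x * y) - 3 / 4 * y * d2 x y ^ 2 =
      ((1 + x) * (1 + y + x * y) ^ 2 * (1 + y) ^ 2
          + y * (1 + x) ^ 2 * (1 + y + x * y) * (1 + y) ^ 2
          - 3 / 4 * y * (x * y ^ 2) ^ 2 * (1 + x) ^ 4) / ((1 + x) * (1 + y + x * y) * (1 + y)) ^ 2 := by
    unfold d2
    field_simp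
  have e2 : d1 x y + 2 / 3 + y * d2 x y =
      (2 / 3 * (1 + x) * (1 + y + x * y) * (1 + y) - x * (1 + y + x * y) * (1 + y)
          - x * y * (1 + x) * (1 + y) - (1 - y) * (x * y ^ 2) * (1 + x) ^ 2) / ((1 + x) * (1 + y + x * y) * (1 + y)) := by
    unfold d1 d2
    field_simp
    ring
  have e3 : 4 / 3 * (2 - y) * (1 / (1 + x) + y / (1 + y + x * y) - 3 / 4 * y * d2 x y ^ 2)
      - (d1 x y + 2 / 3 + y * d2 x y) ^ 2 =
      (4 / 3 * (2 - y) * ((1 + x) * (1 + y + x * y) ^ 2 * (1 + y) ^ 2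
          + y * (1 + x) ^ 2 * (1 + y + x * y) * (1 + y) ^ 2
          - 3 / 4 * y * (x * y ^ 2) ^ 2 * (1 + x) ^ 4)
        - (2 / 3 * (1 + x) * (1 + y + x * y) * (1 + y) - x * (1 + y + x * y) * (1 + y)
          - x * y * (1 + x) * (1 + y) - (1 - y) * (x * y ^ 2) * (1 + x) ^ 2) ^ 2)
        / ((1 + x) * (1 + y + x * y) * (1 + y)) ^ 2 := by
    rw [e1, e2, div_pow, ← mul_div_assoc, ← sub_div]
  rw [e3]
  refine div_nonneg ?_ (by positivity)
  obtain ⟨a, ha⟩ : ∃ a, a = 3 / 2 - x := ⟨_, rfl⟩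
  obtain ⟨b, hb⟩ : ∃ b, b = 3 / 2 - y := ⟨_, rfl⟩
  have ha0 : 0 ≤ a := by linarith
  have hb0 : 0 ≤ b := by linarith
  have key : 4 / 3 * (2 - y) * ((1 + x) * (1 + y + x * y) ^ 2 * (1 + y) ^ 2
          + y * (1 + x) ^ 2 * (1 + y + x * y) * (1 + y) ^ 2
          - 3 / 4 * y * (x * y ^ 2) ^ 2 * (1 + x) ^ 4)
        - (2 / 3 * (1 + x) * (1 + y + x * y) * (1 + y) - x * (1 + y + x * y) * (1 + y)
          - x * y * (1 + x) * (1 + y) - (1 - y) * (x * y ^ 2) * (1 + x) ^ 2) ^ 2 = (2 / 3) ^ 11 / 9216 * (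
      a ^ 6 * (20480 * b ^ 5 + 243712 * y * b ^ 4 + 1074176 * y ^ 2 * b ^ 3 + 2117120 * y
        ^ 3 * b ^ 2 + 1676800 * y ^ 4 * b + 224000 * y ^ 5)
      + x * a ^ 5 * (165888 * b ^ 5 + 2138112 * y * b ^ 4 + 10128384 * y ^ 2 * b ^ 3 +
        21392640 * y ^ 3 * b ^ 2 + 18288000 * y ^ 4 * b + 2952000 * y ^ 5)
      + x ^ 2 * a ^ 4 * (519936 * b ^ 5 + 7306752 * y * b ^ 4 + 37220928 * y ^ 2 * b ^ 3 +
        83679936 * y ^ 3 * b ^ 2 + 75664272 * y ^ 4 * b + 13250544 * y ^ 5)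
      + x ^ 3 * a ^ 3 * (830464 * b ^ 5 + 12678656 * y * b ^ 4 + 69041920 * y ^ 2 * b ^ 3
        + 163213504 * y ^ 3 * b ^ 2 + 152517344 * y ^ 4 * b + 27403600 * y ^ 5)
      + x ^ 4 * a ^ 2 * (723456 * b ^ 5 + 11920896 * y * b ^ 4 + 68714784 * y ^ 2 * b ^ 3
        + 167351040 * y ^ 3 * b ^ 2 + 155625696 * y ^ 4 * b + 27683640 * y ^ 5)
      + x ^ 5 * a * (328704 * b ^ 5 + 5804544 * y * b ^ 4 + 34990656 * y ^ 2 * b ^ 3 +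
        84890976 * y ^ 3 * b ^ 2 + 72300360 * y ^ 4 * b + 12112800 * y ^ 5)
      + x ^ 6 * (61184 * b ^ 5 + 1149952 * y * b ^ 4 + 7151072 * y ^ 2 * b ^ 3 + 16349024
        * y ^ 3 * b ^ 2 + 9607495 * y ^ 4 * b + 778775 * y ^ 5)) := by
    rw [ha, hb]
    ring
  rw [key]
  positivity

end Coefficients

/-- A quadratic form that decreases along every recurrence `w = a v₁ - b v₂` whose coefficients
lie in the rectangle `[0, 87/100] × [0, 7/20]`. -/
theorem lyapunov_le {a b : ℝ} (ha : 0 ≤ a) (ha' : a ≤ 87 / 100) (hb : 0 ≤ b) (hb' : b ≤ 7 / 20)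
    (v w : ℝ) :
    (a * v - b * w) ^ 2 - 2 / 5 * (a * v - b * w) * v + v ^ 2 / 4 ≤
      361 / 400 * (v ^ 2 - 2 / 5 * v * w + w ^ 2 / 4) := by
  set B := 361 / 400 * (v ^ 2 - 2 / 5 * v * w + w ^ 2 / 4) with hB
  -- The left side is convex in `u = a * v - b * w`, so it suffices to bound it at the ends of the
  -- range of `u`. These ends come from corners of the coefficient rectangle, selected by the signs
  -- of `v` and `w`.
  have conv : ∀ l h u : ℝ, l ≤ u → u ≤ h → l ^ 2 - 2 / 5 * l * v + v ^ 2 / 4 ≤ B →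
      h ^ 2 - 2 / 5 * h * v + v ^ 2 / 4 ≤ B → u ^ 2 - 2 / 5 * u * v + v ^ 2 / 4 ≤ B := by
    intro l h u h1 h2 h3 h4
    by_contra! h5
    rcases h1.eq_or_lt with rfl | h1
    · linarith
    have h6 : l < h := h1.trans_le h2
    nlinarith [mul_nonneg (sub_nonneg.2 h1.le) (sub_nonneg.2 h2),
      mul_nonneg (mul_nonneg (sub_nonneg.2 h1.le) (sub_nonneg.2 h2)) (sub_nonneg.2 h6.le)]
  have c00 : (0 : ℝ) ^ 2 - 2 / 5 * 0 * v + v ^ 2 / 4 ≤ B := by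
    rw [hB]
    nlinarith [sq_nonneg (v - 2 / 5 * w), sq_nonneg v, sq_nonneg w]
  have c10 : (87 / 100 * v) ^ 2 - 2 / 5 * (87 / 100 * v) * v + v ^ 2 / 4 ≤ B := by
    rw [hB]
    nlinarith [sq_nonneg (v - 4 / 5 * w), sq_nonneg v, sq_nonneg w]
  have c01 : (-(7 / 20) * w) ^ 2 - 2 / 5 * (-(7 / 20) * w) * v + v ^ 2 / 4 ≤ B := by
    rw [hB]
    nlinarith [sq_nonneg (v - 2 / 5 * w), sq_nonneg v, sq_nonneg w]
  have c11 : (87 / 100 * v - 7 / 20 * w) ^ 2 - 2 / 5 * (87 / 100 * v - 7 / 20 * w) * v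
      + v ^ 2 / 4 ≤ B := by
    rw [hB]
    nlinarith [sq_nonneg (v - 2 / 5 * w), sq_nonneg v, sq_nonneg w, sq_nonneg (v + 2 / 5 * w)]
  rcases le_total 0 v with hv | hv <;> rcases le_total 0 w with hw | hw
  · exact conv (-(7 / 20) * w) (87 / 100 * v) _ (by nlinarith) (by nlinarith) c01 c10
  · exact conv 0 (87 / 100 * v - 7 / 20 * w) _ (by nlinarith) (by nlinarith) c00 c11
  · exact conv (87 / 100 * v - 7 / 20 * w) 0 _ (by nlinarith) (by nlinarith) c11 c00
  · exact conv (87 / 100 * v) (-(7 / 20) * w) _ (by nlinarith) (by nlinarith) c10 c01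

/-- Positivity of the BDF3 quadratic form, relative to the energy
`τ_k ‖v_k‖² - (2/3) τ_k ⟪v_k, v_{k-1}⟫ + (1/3) τ_{k-1} ‖v_{k-1}‖²`. -/
theorem quadForm_nonneg {E : Type*} [NormedAddCommGroup E] [InnerProductSpace ℝ E] {x y : ℝ}
    (hx : 0 ≤ x) (hy : 0 ≤ y) (hx' : x ≤ 3 / 2) (hy' : y ≤ 3 / 2) (X Y Z : E) :
    0 ≤ x * y * ((d0 x y - 1) * ‖X‖ ^ 2 + (d1 x y + 2 / 3) * inner ℝ X Y + d2 x y * inner ℝ X Z)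
      + 2 / 3 * y * ‖Y‖ ^ 2 - 2 / 3 * y * inner ℝ Y Z + 1 / 3 * ‖Z‖ ^ 2 := by
  have hd := discriminant_nonneg hx hy hx' hy'
  set e := 1 / (1 + x) + y / (1 + y + x * y) - 3 / 4 * y * d2 x y ^ 2 with he
  set m := d1 x y + 2 / 3 + y * d2 x y with hm
  have h0 : d0 x y - 1 = x * (e + 3 / 4 * y * d2 x y ^ 2) := by
    have hX : 0 < 1 + x := by linarith
    have hQ : 0 < 1 + y + x * y := by positivity
    rw [he, d0]
    field_simp
    ring
  have h1 : d1 x y + 2 / 3 = m - y * d2 x y := by rw [hm]; ring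
  -- One third of this square absorbs every term containing `Z`. What is left is `y` times a binary
  -- form in `X, Y`, whose discriminant condition is `discriminant_nonneg`.
  have s1 : ‖Z - y • Y + (3 / 2 * (x * y * d2 x y)) • X‖ ^ 2 =
      ‖Z‖ ^ 2 + y ^ 2 * ‖Y‖ ^ 2 + (3 / 2 * (x * y * d2 x y)) ^ 2 * ‖X‖ ^ 2
        - 2 * y * inner ℝ Y Z + 3 * (x * y * d2 x y) * inner ℝ X Z
        - 3 * y * (x * y * d2 x y) * inner ℝ X Y := by
    simp only [← real_inner_self_eq_norm_sq, inner_add_left, inner_add_right, inner_sub_left,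
      inner_sub_right, real_inner_smul_left, real_inner_smul_right, real_inner_comm Z Y,
      real_inner_comm Z X, real_inner_comm Y X]
    ring
  have s2 : ‖((2 - y) / 3) • Y + (x * m / 2) • X‖ ^ 2 =
      ((2 - y) / 3) ^ 2 * ‖Y‖ ^ 2 + (2 - y) / 3 * (x * m) * inner ℝ X Y
        + (x * m / 2) ^ 2 * ‖X‖ ^ 2 := by
    simp only [← real_inner_self_eq_norm_sq, inner_add_left, inner_add_right,
      real_inner_smul_left, real_inner_smul_right, real_inner_comm Y X]
    ring
  have hg : 0 < (2 - y) / 3 := by linarith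
  have key : 0 ≤ x ^ 2 * e * ‖X‖ ^ 2 + x * m * inner ℝ X Y + (2 - y) / 3 * ‖Y‖ ^ 2 := by
    refine nonneg_of_mul_nonneg_right ?_ hg
    have : 0 ≤ x ^ 2 * ‖X‖ ^ 2 / 4 * (4 / 3 * (2 - y) * e - m ^ 2) :=
      mul_nonneg (by positivity) (by linarith)
    have := sq_nonneg ‖((2 - y) / 3) • Y + (x * m / 2) • X‖
    nlinarith
  have := mul_nonneg hy key
  have := sq_nonneg ‖Z - y • Y + (3 / 2 * (x * y * d2 x y)) • X‖
  rw [h0, h1]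
  nlinarith

/-! ### Recurrence and decay of the orthogonal convolution kernels -/

/-- The kernel preceding `doc t n m`, with value `0` for `m = 0`. -/
def docPrev (t : ℕ → ℝ) (n : ℕ) : ℕ → ℝ
  | 0 => 0
  | m + 1 => doc t n m

/-- The kernels vanish from index `3` on, so only the last two terms of the convolution survive. For
`m = 0` the truncated `m - 1` is harmless, because `docPrev` is then `0`. -/
theorem doc_succ (t : ℕ → ℝ) (n m : ℕ) :
    doc t n (m + 1) = -(1 / kernel t (n - (m + 1)) 0) *
      (doc t n m * kernel t (n - m) 1 + docPrev t n m * kernel t (n - (m - 1)) 2) := by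
  rw [doc, Fin.sum_univ_eq_sum_range
    (fun l => doc t n l * kernel t (n - l) (m + 1 - l)) (m + 1)]
  congr 1
  cases m with
  | zero => simp [docPrev]
  | succ m =>
    have h0 : ∑ l ∈ Finset.range m, doc t n l * kernel t (n - l) (m + 1 + 1 - l) = 0 := by
      refine Finset.sum_eq_zero fun l hl => ?_
      obtain ⟨q, hq⟩ : ∃ q, m + 1 + 1 - l = q + 3 :=
        ⟨m + 1 + 1 - l - 3, by have := Finset.mem_range.1 hl; omega⟩
      rw [hq]
      simp [kernel]
    have h1 : m + 1 + 1 - (m + 1) = 1 := by omega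
    have h2 : m + 1 + 1 - m = 2 := by omega
    rw [Finset.sum_range_succ, Finset.sum_range_succ, h0, h1, h2]
    simp only [docPrev, Nat.add_sub_cancel]
    ring

theorem doc_succ_mul (t : ℕ → ℝ) (n m : ℕ) (h : kernel t (n - (m + 1)) 0 ≠ 0) :
    doc t n (m + 1) * kernel t (n - (m + 1)) 0 =
      -(doc t n m * kernel t (n - m) 1 + docPrev t n m * kernel t (n - (m - 1)) 2) := by
  rw [doc_succ]
  field_simp

/-- All ratios up to level `N` lie in `(0, 3/2]`. -/
def RatioBound (t : ℕ → ℝ) (N : ℕ) : Prop :=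
  ∀ k, 2 ≤ k → k ≤ N → 0 < ratio t k ∧ ratio t k ≤ 3 / 2

theorem sum_Icc_reflect {V : Type*} [AddCommMonoid V] {n : ℕ} (hn : 3 ≤ n) (F : ℕ → ℕ → V) :
    ∑ j ∈ Finset.Icc 3 n, F (n - j) j = ∑ l ∈ Finset.range (n - 3 + 1), F l (n - l) := by
  refine Finset.sum_bij' (fun j _ => n - j) (fun l _ => n - l) ?_ ?_ ?_ ?_ ?_
  all_goals intro a ha; simp only [Finset.mem_range, Finset.mem_Icc] at *
  · omega
  · omega
  · omega
  · omega
  · congr 1; omega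

theorem sum_geometric_le (k : ℕ) :
    ∑ l ∈ Finset.range k, 11 / 10 * (19 / 20 : ℝ) ^ l ≤ 22 := by
  have e : ((19 / 20 : ℝ) ^ k - 1) / (19 / 20 - 1) = 20 * (1 - (19 / 20) ^ k) := by ring
  rw [← Finset.mul_sum, geom_sum_eq (by norm_num), e]
  have : (0 : ℝ) ≤ (19 / 20) ^ k := by positivity
  linarith

section

variable {t : ℕ → ℝ} {N : ℕ}

theorem RatioBound.kernel_zero (hr : RatioBound t N) {k : ℕ} (hk : 3 ≤ k) (hkN : k ≤ N) :
    1 ≤ kernel t k 0 ∧ kernel t k 0 ≤ 21 / 10 := by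
  obtain ⟨h1, h2⟩ := hr k (by omega) hkN
  obtain ⟨h3, h4⟩ := hr (k - 1) (by omega) (by omega)
  exact ⟨d0_ge_one h1.le h3.le, d0_le h1.le h3.le h2 h4⟩

theorem RatioBound.kernel_one (hr : RatioBound t N) {k : ℕ} (hk : 3 ≤ k) (hkN : k ≤ N) :
    0 ≤ -kernel t k 1 ∧ -kernel t k 1 ≤ 87 / 100 * kernel t k 0 := by
  obtain ⟨h1, h2⟩ := hr k (by omega) hkN
  obtain ⟨h3, h4⟩ := hr (k - 1) (by omega) (by omega)
  exact ⟨neg_nonneg.2 (d1_nonpos h1.le h3.le), neg_d1_le_mul_d0 h1.le h3.le h2 h4⟩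

theorem RatioBound.kernel_two (hr : RatioBound t N) {k : ℕ} (hk : 3 ≤ k) (hkN : k ≤ N) :
    0 ≤ kernel t k 2 ∧ kernel t k 2 ≤ 7 / 20 * kernel t k 0 := by
  obtain ⟨h1, h2⟩ := hr k (by omega) hkN
  obtain ⟨h3, h4⟩ := hr (k - 1) (by omega) (by omega)
  exact ⟨d2_nonneg h1.le h3.le, d2_le_mul_d0 h1.le h3.le h2 h4⟩

/-- Multiplying each DOC kernel by the leading kernel of its own level makes both recurrence
coefficients quotients of kernels at one level, which the coefficient bounds control. The form
starts at `1` and contracts at each step. -/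
theorem RatioBound.lyapunov (hr : RatioBound t N) {n : ℕ} (hnN : n ≤ N) (m : ℕ) (hm : m + 3 ≤ n) :
    (doc t n m * kernel t (n - m) 0) ^ 2
      - 2 / 5 * (doc t n m * kernel t (n - m) 0) * (docPrev t n m * kernel t (n - (m - 1)) 0)
      + (docPrev t n m * kernel t (n - (m - 1)) 0) ^ 2 / 4 ≤ (361 / 400) ^ m := by
  induction m with
  | zero =>
    have h := (hr.kernel_zero (k := n) (by omega) hnN).1
    have : doc t n 0 * kernel t (n - 0) 0 = 1 := by
      rw [doc_zero, Nat.sub_zero]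
      field_simp
    rw [this]
    simp [docPrev]
  | succ m ih =>
    have h0 := (hr.kernel_zero (k := n - (m + 1)) (by omega) (by omega)).1
    have hk := (hr.kernel_zero (k := n - m) (by omega) (by omega)).1
    have hk' := (hr.kernel_zero (k := n - (m - 1)) (by omega) (by omega)).1
    obtain ⟨ha, ha'⟩ := hr.kernel_one (k := n - m) (by omega) (by omega)
    obtain ⟨hb, hb'⟩ := hr.kernel_two (k := n - (m - 1)) (by omega) (by omega)
    have hl := lyapunov_le (a := -kernel t (n - m) 1 / kernel t (n - m) 0)
      (b := kernel t (n - (m - 1)) 2 / kernel t (n - (m - 1)) 0)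
      (div_nonneg ha (by linarith)) ((div_le_iff₀ (by linarith)).2 ha')
      (div_nonneg hb (by linarith)) ((div_le_iff₀ (by linarith)).2 hb')
      (doc t n m * kernel t (n - m) 0) (docPrev t n m * kernel t (n - (m - 1)) 0)
    have e : doc t n (m + 1) * kernel t (n - (m + 1)) 0 =
        -kernel t (n - m) 1 / kernel t (n - m) 0 * (doc t n m * kernel t (n - m) 0)
        - kernel t (n - (m - 1)) 2 / kernel t (n - (m - 1)) 0 *
          (docPrev t n m * kernel t (n - (m - 1)) 0) := by
      rw [doc_succ_mul t n m (by linarith)]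
      field_simp
      ring
    have e' : docPrev t n (m + 1) * kernel t (n - (m + 1 - 1)) 0 =
        doc t n m * kernel t (n - m) 0 := rfl
    rw [e', e, pow_succ' (361 / 400 : ℝ)]
    exact hl.trans (mul_le_mul_of_nonneg_left (ih (by omega)) (by norm_num))

theorem RatioBound.abs_doc_le (hr : RatioBound t N) {n : ℕ} (hnN : n ≤ N) (m : ℕ) (hm : m + 3 ≤ n) :
    |doc t n m| ≤ 11 / 10 * (19 / 20) ^ m := by
  have h := hr.lyapunov hnN m hm
  have h0 := (hr.kernel_zero (k := n - m) (by omega) (by omega)).1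
  set w := doc t n m * kernel t (n - m) 0 with hw
  set v := docPrev t n m * kernel t (n - (m - 1)) 0
  -- Minimizing the form over `v` leaves `21/25 * w²`, and `25/21 ≤ (11/10)²`.
  have h1 : w ^ 2 ≤ (11 / 10 * (19 / 20) ^ m) ^ 2 := by
    have : ((361 : ℝ) / 400) ^ m = ((19 / 20) ^ m) ^ 2 := by
      rw [← pow_mul, mul_comm, pow_mul]
      norm_num
    rw [this] at h
    nlinarith [sq_nonneg (v / 2 - 2 / 5 * w), sq_nonneg ((19 / 20 : ℝ) ^ m)]
  have h2 := abs_le_of_sq_le_sq h1 (by positivity)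
  have h3 : |doc t n m| ≤ |w| := by
    rw [hw, abs_mul, abs_of_pos (by linarith : 0 < kernel t (n - m) 0)]
    exact le_mul_of_one_le_right (abs_nonneg _) h0
  exact h3.trans h2

theorem RatioBound.sum_abs_doc_row_le (hr : RatioBound t N) {n : ℕ} (hnN : n ≤ N) :
    ∑ j ∈ Finset.Icc 3 n, |doc t n (n - j)| ≤ 22 := by
  rcases lt_or_ge n 3 with hn | hn
  · simp [Finset.Icc_eq_empty_of_lt hn]
  rw [sum_Icc_reflect hn fun l _ => |doc t n l|]
  refine le_trans (Finset.sum_le_sum fun l hl => ?_) (sum_geometric_le (n - 3 + 1))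
  rw [Finset.mem_range] at hl
  exact hr.abs_doc_le hnN l (by omega)

theorem RatioBound.sum_abs_doc_column_le (hr : RatioBound t N) {n i : ℕ} (hnN : n ≤ N) (hi : 3 ≤ i) :
    ∑ j ∈ Finset.Icc i n, |doc t j (j - i)| ≤ 22 := by
  have h : ∀ j ∈ Finset.Icc i n, |doc t j (j - i)| ≤ 11 / 10 * (19 / 20) ^ (j - i) := by
    intro j hj
    rw [Finset.mem_Icc] at hj
    exact hr.abs_doc_le (hj.2.trans hnN) (j - i) (by omega)
  refine (Finset.sum_le_sum h).trans (le_trans (le_of_eq ?_) (sum_geometric_le (n + 1 - i)))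
  rw [← Finset.Ico_add_one_right_eq_Icc, Finset.sum_Ico_eq_sum_range]
  simp

end

/-- The DOC kernels invert `D₃`, up to the contribution of the starting values. -/
theorem sum_doc_smul {V : Type*} [AddCommGroup V] [Module ℝ V] (t : ℕ → ℝ) (p : ℕ → V) (n m : ℕ)
    (hk : ∀ l ≤ m, kernel t (n - l) 0 ≠ 0) :
    ∑ l ∈ Finset.range (m + 1), doc t n l • (kernel t (n - l) 0 • p (n - l)
        + kernel t (n - l) 1 • p (n - l - 1) + kernel t (n - l) 2 • p (n - l - 2)) =
      p n + (doc t n m * kernel t (n - m) 1 + docPrev t n m * kernel t (n - (m - 1)) 2) •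
          p (n - m - 1)
        + (doc t n m * kernel t (n - m) 2) • p (n - m - 2) := by
  induction m with
  | zero =>
    have := hk 0 le_rfl
    simp only [Nat.sub_zero] at this
    simp [docPrev, doc_zero, smul_add, smul_smul, this]
  | succ m ih =>
    rw [Finset.sum_range_succ, ih fun l hl => hk l (by omega)]
    have e := doc_succ_mul t n m (hk (m + 1) le_rfl)
    have e' : doc t n m * kernel t (n - m) 1 + docPrev t n m * kernel t (n - (m - 1)) 2 =
      -(doc t n (m + 1) * kernel t (n - (m + 1)) 0) := by linarith
    -- By the recurrence, the boundary coefficient of the old partial sum cancels the leading part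
    -- of the new summand.
    have i1 : n - m - 1 = n - (m + 1) := by omega
    have i2 : n - m - 2 = n - (m + 1) - 1 := by omega
    rw [e', i1, i2]
    simp only [docPrev, Nat.add_sub_cancel, smul_add, smul_smul]
    module

theorem sum_doc_smul_Icc {V : Type*} [AddCommGroup V] [Module ℝ V] (t : ℕ → ℝ) (p : ℕ → V) {n : ℕ}
    (hn : 3 ≤ n) (hk : ∀ j, 3 ≤ j → j ≤ n → kernel t j 0 ≠ 0) :
    ∑ j ∈ Finset.Icc 3 n, doc t n (n - j) • (kernel t j 0 • p j
        + kernel t j 1 • p (j - 1) + kernel t j 2 • p (j - 2)) =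
      p n + (doc t n (n - 3) * kernel t 3 1 + docPrev t n (n - 3) * kernel t 4 2) • p 2
        + (doc t n (n - 3) * kernel t 3 2) • p 1 := by
  rw [sum_Icc_reflect hn fun l j => doc t n l • (kernel t j 0 • p j
        + kernel t j 1 • p (j - 1) + kernel t j 2 • p (j - 2)),
    sum_doc_smul t p n (n - 3) fun l hl => hk _ (by omega) (by omega)]
  have h3 : n - (n - 3) = 3 := by omega
  rw [h3]
  rcases hn.eq_or_lt with rfl | hn
  · simp [docPrev]
  · have h4 : n - (n - 3 - 1) = 4 := by omega
    rw [h4]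

/-! ### Positivity of the orthogonal convolution kernels -/

theorem IsTimeMesh.step_pos {t : ℕ → ℝ} {N k : ℕ} (ht : IsTimeMesh t N) (hk : 1 ≤ k)
    (hkN : k ≤ N) : 0 < step t k := by
  have := ht.2 (k - 1) (by omega)
  rw [Nat.sub_add_cancel hk] at this
  exact sub_pos.2 this

theorem IsTimeMesh.step_eq {t : ℕ → ℝ} {N k : ℕ} (ht : IsTimeMesh t N) (hk : 2 ≤ k)
    (hkN : k ≤ N) : step t k = ratio t k * step t (k - 1) := by
  have := ht.step_pos (k := k - 1) (by omega) (by omega)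
  rw [ratio, div_mul_cancel₀ _ this.ne']

/-- The solution of `D ψ = x` with vanishing starting values, `D` the BDF3 kernels. -/
def kernelSolve {E : Type*} [AddCommGroup E] [Module ℝ E] (t : ℕ → ℝ) (x : ℕ → E) : ℕ → E
  | 0 => 0
  | 1 => 0
  | 2 => 0
  | k + 3 => (kernel t (k + 3) 0)⁻¹ • (x (k + 3) - kernel t (k + 3) 1 • kernelSolve t x (k + 2)
      - kernel t (k + 3) 2 • kernelSolve t x (k + 1))

theorem kernelSolve_spec {E : Type*} [AddCommGroup E] [Module ℝ E] (t : ℕ → ℝ) (x : ℕ → E) {k : ℕ}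
    (hk : 3 ≤ k) (h : kernel t k 0 ≠ 0) :
    kernel t k 0 • kernelSolve t x k + kernel t k 1 • kernelSolve t x (k - 1)
      + kernel t k 2 • kernelSolve t x (k - 2) = x k := by
  obtain ⟨k, rfl⟩ := Nat.exists_eq_add_of_le' hk
  have h1 : k + 3 - 1 = k + 2 := by omega
  have h2 : k + 3 - 2 = k + 1 := by omega
  rw [h1, h2, kernelSolve, smul_inv_smul₀ h]
  abel

theorem sub_le_sum_of_sub_le {a b : ℕ → ℝ} {N : ℕ}
    (h : ∀ k, 3 ≤ k → k ≤ N → a k - a (k - 1) ≤ b k) {m : ℕ} (hm : 2 ≤ m) (hmN : m ≤ N) :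
    a m - a 2 ≤ ∑ k ∈ Finset.Icc 3 m, b k := by
  induction m, hm using Nat.le_induction with
  | base => simp
  | succ m hm ih =>
    have h1 := h (m + 1) (by omega) hmN
    have h2 := ih (by omega)
    rw [Finset.sum_Icc_succ_top (by omega)]
    rw [Nat.add_sub_cancel] at h1
    linarith

section

variable {E : Type*} [NormedAddCommGroup E] [InnerProductSpace ℝ E]

/-- The discrete energy of the BDF3 quadratic form. -/
def energy (t : ℕ → ℝ) (v : ℕ → E) (k : ℕ) : ℝ :=
  step t k * ‖v k‖ ^ 2 - 2 / 3 * step t k * inner ℝ (v k) (v (k - 1))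
    + 1 / 3 * step t (k - 1) * ‖v (k - 1)‖ ^ 2

theorem energy_nonneg {t : ℕ → ℝ} {N k : ℕ} (ht : IsTimeMesh t N) (hr : RatioBound t N)
    (hk : 2 ≤ k) (hkN : k ≤ N) (v : ℕ → E) : 0 ≤ energy t v k := by
  obtain ⟨h1, h2⟩ := hr k hk hkN
  have h3 := ht.step_pos (k := k - 1) (by omega) (by omega)
  rw [energy, ht.step_eq hk hkN]
  -- Completing the square in `v (k - 1)` leaves the factor `1 - ratio t k / 3`, positive for ratios
  -- up to `3/2`.
  have e : ‖v (k - 1) - ratio t k • v k‖ ^ 2 = ‖v (k - 1)‖ ^ 2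
      - 2 * ratio t k * inner ℝ (v k) (v (k - 1)) + ratio t k ^ 2 * ‖v k‖ ^ 2 := by
    rw [norm_sub_sq_real, real_inner_smul_right, norm_smul, mul_pow, Real.norm_eq_abs, sq_abs,
      real_inner_comm]
    ring
  have h4 : 0 ≤ step t (k - 1) * (1 / 3 * ‖v (k - 1) - ratio t k • v k‖ ^ 2
      + ratio t k * (1 - ratio t k / 3) * ‖v k‖ ^ 2) := by
    have : 0 ≤ 1 - ratio t k / 3 := by linarith
    positivity
  rw [e] at h4
  linarith

/-- Expressing all steps through `step t (k - 2)`, right side minus left side is that step times the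
form of `quadForm_nonneg`. -/
theorem energy_sub_le {t : ℕ → ℝ} {N k : ℕ} (ht : IsTimeMesh t N) (hr : RatioBound t N)
    (hk : 3 ≤ k) (hkN : k ≤ N) (v : ℕ → E) :
    energy t v k - energy t v (k - 1) ≤ step t k * inner ℝ (kernel t k 0 • v k
      + kernel t k 1 • v (k - 1) + kernel t k 2 • v (k - 2)) (v k) := by
  obtain ⟨h1, h2⟩ := hr k (by omega) hkN
  obtain ⟨h3, h4⟩ := hr (k - 1) (by omega) (by omega)
  have hp := ht.step_pos (k := k - 2) (by omega) (by omega)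
  have e1 := ht.step_eq (k := k) (by omega) hkN
  have e2 := ht.step_eq (k := k - 1) (by omega) (by omega)
  have i1 : k - 1 - 1 = k - 2 := by omega
  rw [i1] at e2
  have h := mul_nonneg hp.le
    (quadForm_nonneg h1.le h3.le h2 h4 (v k) (v (k - 1)) (v (k - 2)))
  rw [energy, energy, i1, e1, e2, inner_add_left, inner_add_left, real_inner_smul_left,
    real_inner_smul_left, real_inner_smul_left, real_inner_self_eq_norm_sq,
    real_inner_comm (v k) (v (k - 1)), real_inner_comm (v k) (v (k - 2))]
  simp only [kernel]
  linarith

theorem sum_doc_inner_nonneg {t : ℕ → ℝ} {N n : ℕ} (ht : IsTimeMesh t N) (hr : RatioBound t N)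
    (hn : 3 ≤ n) (hnN : n ≤ N) (x : ℕ → E) :
    0 ≤ ∑ k ∈ Finset.Icc 3 n, step t k *
      ∑ j ∈ Finset.Icc 3 k, doc t k (k - j) * inner ℝ (x j) (x k) := by
  set v := kernelSolve t x with hv
  have hd : ∀ j, 3 ≤ j → j ≤ N → kernel t j 0 ≠ 0 := fun j h1 h2 => by
    have := (hr.kernel_zero h1 h2).1
    linarith
  -- The DOC convolution of `x = D v` returns `v k` with no boundary terms, since `v 1 = v 2 = 0`.
  have hx : ∀ k, 3 ≤ k → k ≤ N → step t k * ∑ j ∈ Finset.Icc 3 k, doc t k (k - j) *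
      inner ℝ (x j) (x k) = step t k * inner ℝ (kernel t k 0 • v k
      + kernel t k 1 • v (k - 1) + kernel t k 2 • v (k - 2)) (v k) := by
    intro k hk hkN
    rw [hv, kernelSolve_spec t x hk (hd k hk hkN)]
    have h := sum_doc_smul_Icc t v hk fun j h1 h2 => hd j h1 (h2.trans hkN)
    have h0 : v 2 = 0 ∧ v 1 = 0 := ⟨by rw [hv, kernelSolve], by rw [hv, kernelSolve]⟩
    rw [h0.1, h0.2, smul_zero, smul_zero, add_zero, add_zero] at h
    rw [← hv, ← h, inner_sum]
    congr 1
    refine Finset.sum_congr rfl fun j hj => ?_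
    rw [Finset.mem_Icc] at hj
    rw [hv, kernelSolve_spec t x hj.1 (hd j hj.1 (hj.2.trans hkN)), real_inner_smul_right,
      real_inner_comm]
  have h0 : energy t v 2 = 0 := by simp [energy, hv, kernelSolve]
  have hsum := sub_le_sum_of_sub_le (fun k hk hkN => (energy_sub_le ht hr hk hkN v).trans_eq
    (hx k hk hkN).symm) (by omega : 2 ≤ n) hnN
  rw [h0, sub_zero] at hsum
  exact (energy_nonneg ht hr (by omega) hnN v).trans hsum

/-! ### The energy estimate in Hilbert spaces -/

/-- At an index `m` where `a` is largest, one factor of each product is bounded by `a m`, which can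
then be cancelled. -/
theorem le_add_sum_of_sq_le {a s : ℕ → ℝ} {n : ℕ} (hn : 2 ≤ n) (ha : ∀ k, 0 ≤ a k)
    (hs : ∀ k, 3 ≤ k → k ≤ n → 0 ≤ s k)
    (h : ∀ m, 3 ≤ m → m ≤ n → a m ^ 2 ≤ a 2 ^ 2 + ∑ k ∈ Finset.Icc 3 m, s k * a k) :
    a n ≤ a 2 + ∑ k ∈ Finset.Icc 3 n, s k := by
  obtain ⟨m, hm, hmax⟩ := Finset.exists_max_image (Finset.Icc 2 n) a (Finset.nonempty_Icc.2 hn)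
  rw [Finset.mem_Icc] at hm
  have hs0 : 0 ≤ ∑ k ∈ Finset.Icc 3 n, s k :=
    Finset.sum_nonneg fun k hk => hs k (Finset.mem_Icc.1 hk).1 (Finset.mem_Icc.1 hk).2
  refine (hmax n (Finset.mem_Icc.2 ⟨hn, le_rfl⟩)).trans ?_
  rcases hm.1.eq_or_lt with rfl | hm2
  · linarith
  rcases (ha m).eq_or_lt with h0 | h0
  · rw [← h0]
    linarith [ha 2]
  have h1 : ∑ k ∈ Finset.Icc 3 m, s k * a k ≤ (∑ k ∈ Finset.Icc 3 n, s k) * a m := by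
    rw [Finset.sum_mul]
    refine (Finset.sum_le_sum fun k hk => ?_).trans
      (Finset.sum_le_sum_of_subset_of_nonneg (Finset.Icc_subset_Icc_right hm.2) fun k hk _ => ?_)
    · rw [Finset.mem_Icc] at hk
      exact mul_le_mul_of_nonneg_left (hmax k (Finset.mem_Icc.2 ⟨by omega, by omega⟩))
        (hs k hk.1 (by omega))
    · rw [Finset.mem_Icc] at hk
      exact mul_nonneg (hs k hk.1 hk.2) h0.le
  have h2 : a 2 ≤ a m := hmax 2 (Finset.mem_Icc.2 ⟨le_rfl, hn⟩)
  have h3 := h m hm2 hm.2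
  refine le_of_mul_le_mul_right ?_ h0
  nlinarith [ha 2]

/-- The weight of `∂_τ u²` in the convolved scheme. -/
def startWeight (t : ℕ → ℝ) (k : ℕ) : ℝ :=
  doc t k (k - 3) * kernel t 3 1 + docPrev t k (k - 3) * kernel t 4 2

theorem RatioBound.sum_abs_start_le {t : ℕ → ℝ} {N n : ℕ} (hr : RatioBound t N) (hn : 3 ≤ n)
    (hnN : n ≤ N) :
    ∑ k ∈ Finset.Icc 3 n, |doc t k (k - 3) * kernel t 3 2| ≤ 20 := by
  have h1 := hr.sum_abs_doc_column_le hnN le_rfl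
  obtain ⟨h2, h3⟩ := hr.kernel_two le_rfl (hn.trans hnN)
  have h4 := (hr.kernel_zero le_rfl (hn.trans hnN)).2
  simp only [abs_mul, abs_of_nonneg h2]
  rw [← Finset.sum_mul]
  nlinarith [Finset.sum_nonneg fun k (_ : k ∈ Finset.Icc 3 n) => abs_nonneg (doc t k (k - 3))]

theorem RatioBound.sum_abs_startWeight_le {t : ℕ → ℝ} {N n : ℕ} (hr : RatioBound t N)
    (hn : 3 ≤ n) (hnN : n ≤ N) :
    ∑ k ∈ Finset.Icc 3 n, |startWeight t k| ≤ 80 := by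
  have h1 := hr.sum_abs_doc_column_le hnN le_rfl
  obtain ⟨h2, h3⟩ := hr.kernel_one le_rfl (hn.trans hnN)
  have h4 := (hr.kernel_zero le_rfl (hn.trans hnN)).2
  -- The weights `2` and `1` exceed `0.87 * 2.1` and `0.35 * 2.1`; with column sums at most `22` the
  -- total is `66`.
  have hb : ∀ k ∈ Finset.Icc 3 n, |startWeight t k| ≤
      |doc t k (k - 3)| * 2 + |docPrev t k (k - 3)| * 1 := by
    intro k hk
    rw [Finset.mem_Icc] at hk
    refine (abs_add_le _ _).trans (add_le_add ?_ ?_)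
    · rw [abs_mul]
      refine mul_le_mul_of_nonneg_left ?_ (abs_nonneg _)
      rw [abs_le]
      constructor <;> linarith
    · rw [abs_mul]
      rcases hk.1.eq_or_lt with rfl | hk3
      · simp [docPrev]
      · refine mul_le_mul_of_nonneg_left ?_ (abs_nonneg _)
        obtain ⟨h5, h6⟩ := hr.kernel_two (k := 4) (by omega) (by omega)
        have h7 := (hr.kernel_zero (k := 4) (by omega) (by omega)).2
        rw [abs_le]
        constructor <;> linarith
  -- The shifted kernels form the DOC column of index `4`; the term `k = 3` is `0`.
  have h5 : ∑ k ∈ Finset.Icc 3 n, |docPrev t k (k - 3)| ≤ 22 := by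
    rw [← Finset.add_sum_Ioc_eq_sum_Icc hn]
    refine le_trans (le_of_eq ?_) (hr.sum_abs_doc_column_le (i := 4) hnN (by omega))
    have : Finset.Ioc 3 n = Finset.Icc 4 n := by
      ext k
      simp only [Finset.mem_Ioc, Finset.mem_Icc]
      omega
    rw [this]
    simp only [docPrev, Nat.sub_self, abs_zero, zero_add]
    refine Finset.sum_congr rfl fun k hk => ?_
    rw [Finset.mem_Icc] at hk
    have : k - 3 = k - 4 + 1 := by omega
    rw [this]
  refine (Finset.sum_le_sum hb).trans ?_
  rw [Finset.sum_add_distrib, ← Finset.sum_mul, ← Finset.sum_mul]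
  linarith

theorem IsTimeMesh.step_le_maxStep {t : ℕ → ℝ} {N k : ℕ} (hN : 1 ≤ N) (hk : 1 ≤ k)
    (hkN : k ≤ N) : step t k ≤ maxStep t N hN :=
  Finset.le_sup' (step t) (Finset.mem_Icc.2 ⟨hk, hkN⟩)

variable {F : Type*} [NormedAddCommGroup F] [InnerProductSpace ℝ F]

/-- The hypothesis pairs the scheme at level `j` with the solution at every level `k`, as the DOC
convolution requires. Here `g` stands for gradients and `q` for `√(-κ) u`. -/
theorem norm_le_of_inner_scheme {t : ℕ → ℝ} {N : ℕ} (hN : 1 ≤ N) (ht : IsTimeMesh t N)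
    (hr : RatioBound t N) {ε : ℝ} (hε : 0 ≤ ε) {u f q : ℕ → E} {g : ℕ → F}
    (h : ∀ j k, 3 ≤ j → j ≤ N → 3 ≤ k → k ≤ N → inner ℝ (D3 t u j) (u k) =
      -(ε * inner ℝ (g j) (g k)) - inner ℝ (q j) (q k) + inner ℝ (f j) (u k))
    {n : ℕ} (hn : 3 ≤ n) (hnN : n ≤ N) :
    ‖u n‖ ≤ ‖u 2‖ + 40 * maxStep t N hN * ‖diffQuot t u 1‖
      + 4 * 40 * maxStep t N hN * ‖diffQuot t u 2‖
      + 2 * ∑ k ∈ Finset.Icc 3 n, step t k *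
          ∑ j ∈ Finset.Icc 3 k, |doc t k (k - j)| * ‖f j‖ := by
  set p := diffQuot t u with hp
  set S : ℕ → ℝ := fun k => |startWeight t k| * ‖p 2‖ + |doc t k (k - 3) * kernel t 3 2| * ‖p 1‖
    + ∑ j ∈ Finset.Icc 3 k, |doc t k (k - j)| * ‖f j‖ with hS
  have hS0 : ∀ k, 0 ≤ S k := fun k => by
    have : 0 ≤ ∑ j ∈ Finset.Icc 3 k, |doc t k (k - j)| * ‖f j‖ :=
      Finset.sum_nonneg fun j _ => by positivity
    positivity
  have hstep : ∀ k, 3 ≤ k → k ≤ N → ‖u k‖ ^ 2 - ‖u (k - 1)‖ ^ 2 ≤ 2 * step t k * S k * ‖u k‖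
      - 2 * ε * (step t k * ∑ j ∈ Finset.Icc 3 k, doc t k (k - j) * inner ℝ (g j) (g k))
      - 2 * (step t k * ∑ j ∈ Finset.Icc 3 k, doc t k (k - j) * inner ℝ (q j) (q k)) := by
    intro k hk hkN
    have hτ := ht.step_pos (k := k) (by omega) hkN
    have h1 := congrArg (fun w => inner ℝ w (u k)) (sum_doc_smul_Icc t p hk fun j h1 h2 =>
      (by linarith [(hr.kernel_zero h1 (h2.trans hkN)).1] : kernel t j 0 ≠ 0))
    have hD : ∀ j, kernel t j 0 • p j + kernel t j 1 • p (j - 1) + kernel t j 2 • p (j - 2) =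
      D3 t u j := fun j => rfl
    simp only [hD, sum_inner, inner_add_left, real_inner_smul_left] at h1
    rw [Finset.sum_congr rfl fun j hj => by
      rw [h j k (Finset.mem_Icc.1 hj).1 ((Finset.mem_Icc.1 hj).2.trans hkN) hk hkN]] at h1
    have h2 : ∑ j ∈ Finset.Icc 3 k, doc t k (k - j) * (-(ε * inner ℝ (g j) (g k))
        - inner ℝ (q j) (q k) + inner ℝ (f j) (u k)) =
        -(ε * ∑ j ∈ Finset.Icc 3 k, doc t k (k - j) * inner ℝ (g j) (g k))
        - ∑ j ∈ Finset.Icc 3 k, doc t k (k - j) * inner ℝ (q j) (q k)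
        + ∑ j ∈ Finset.Icc 3 k, doc t k (k - j) * inner ℝ (f j) (u k) := by
      rw [Finset.mul_sum, ← Finset.sum_neg_distrib, ← Finset.sum_sub_distrib,
        ← Finset.sum_add_distrib]
      exact Finset.sum_congr rfl fun j _ => by ring
    rw [h2] at h1
    have h3 : ∑ j ∈ Finset.Icc 3 k, doc t k (k - j) * inner ℝ (f j) (u k) ≤
        (∑ j ∈ Finset.Icc 3 k, |doc t k (k - j)| * ‖f j‖) * ‖u k‖ := by
      rw [Finset.sum_mul]
      refine Finset.sum_le_sum fun j _ => (le_abs_self _).trans ?_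
      rw [abs_mul, mul_assoc]
      exact mul_le_mul_of_nonneg_left (abs_real_inner_le_norm _ _) (abs_nonneg _)
    have habs : ∀ (c : ℝ) (w : E), -(c * inner ℝ w (u k)) ≤ |c| * ‖w‖ * ‖u k‖ := by
      intro c w
      refine (neg_le_abs _).trans ?_
      rw [abs_mul, mul_assoc]
      exact mul_le_mul_of_nonneg_left (abs_real_inner_le_norm _ _) (abs_nonneg _)
    have h4 := habs (startWeight t k) (p 2)
    have h5 := habs (doc t k (k - 3) * kernel t 3 2) (p 1)
    have h6 : ‖u k‖ ^ 2 - ‖u (k - 1)‖ ^ 2 ≤ 2 * step t k * inner ℝ (p k) (u k) := by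
      have e : step t k * inner ℝ (p k) (u k) = inner ℝ (u k - u (k - 1)) (u k) := by
        rw [hp, diffQuot, real_inner_smul_left, mul_inv_cancel_left₀ hτ.ne']
      rw [mul_assoc, e, inner_sub_left, real_inner_self_eq_norm_sq, real_inner_comm]
      have := norm_sub_sq_real (u k) (u (k - 1))
      have := sq_nonneg ‖u k - u (k - 1)‖
      linarith
    refine h6.trans ?_
    rw [← startWeight] at h1
    have h7 : inner ℝ (p k) (u k) ≤ S k * ‖u k‖
        - ε * ∑ j ∈ Finset.Icc 3 k, doc t k (k - j) * inner ℝ (g j) (g k)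
        - ∑ j ∈ Finset.Icc 3 k, doc t k (k - j) * inner ℝ (q j) (q k) := by
      simp only [hS, add_mul]
      linarith
    have := mul_le_mul_of_nonneg_left h7 (by positivity : 0 ≤ 2 * step t k)
    linarith
  have hsum : ∀ m, 2 ≤ m → m ≤ N → ‖u m‖ ^ 2 - ‖u 2‖ ^ 2 ≤
      ∑ k ∈ Finset.Icc 3 m, 2 * step t k * S k * ‖u k‖
      - 2 * ε * ∑ k ∈ Finset.Icc 3 m, step t k *
          ∑ j ∈ Finset.Icc 3 k, doc t k (k - j) * inner ℝ (g j) (g k)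
      - 2 * ∑ k ∈ Finset.Icc 3 m, step t k *
          ∑ j ∈ Finset.Icc 3 k, doc t k (k - j) * inner ℝ (q j) (q k) := by
    intro m hm hmN
    refine (sub_le_sum_of_sub_le hstep hm hmN).trans (le_of_eq ?_)
    rw [Finset.sum_sub_distrib, Finset.sum_sub_distrib, Finset.mul_sum, Finset.mul_sum]
  have hmain := le_add_sum_of_sq_le (a := fun k => ‖u k‖) (s := fun k => 2 * step t k * S k)
    (n := n) (by omega) (fun k => norm_nonneg _)
    (fun k h1 h2 => mul_nonneg (by linarith [ht.step_pos (k := k) (by omega) (by omega)]) (hS0 k))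
    (fun m h1 h2 => by
      have h3 := hsum m (by omega) (by omega)
      -- Positivity of the DOC form discards diffusion and reaction.
      have h4 := mul_nonneg hε (sum_doc_inner_nonneg ht hr h1 (h2.trans hnN) g)
      have h5 := sum_doc_inner_nonneg ht hr h1 (h2.trans hnN) q
      linarith)
  refine hmain.trans ?_
  have hτ : ∀ k ∈ Finset.Icc 3 n, step t k ≤ maxStep t N hN := fun k hk => by
    rw [Finset.mem_Icc] at hk
    exact IsTimeMesh.step_le_maxStep hN (by omega) (by omega)
  have hτ0 : 0 ≤ maxStep t N hN :=
    (ht.step_pos (k := 1) le_rfl hN).le.trans (IsTimeMesh.step_le_maxStep hN le_rfl hN)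
  have hw : ∀ w : ℕ → ℝ, ∑ k ∈ Finset.Icc 3 n, step t k * |w k| ≤
      maxStep t N hN * ∑ k ∈ Finset.Icc 3 n, |w k| := fun w => by
    rw [Finset.mul_sum]
    exact Finset.sum_le_sum fun k hk => mul_le_mul_of_nonneg_right (hτ k hk) (abs_nonneg _)
  have b1 : ∑ k ∈ Finset.Icc 3 n, step t k * |startWeight t k| ≤ maxStep t N hN * 80 :=
    (hw _).trans (mul_le_mul_of_nonneg_left (hr.sum_abs_startWeight_le hn hnN) hτ0)
  have b2 : ∑ k ∈ Finset.Icc 3 n, step t k * |doc t k (k - 3) * kernel t 3 2| ≤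
      maxStep t N hN * 20 :=
    (hw _).trans (mul_le_mul_of_nonneg_left (hr.sum_abs_start_le hn hnN) hτ0)
  have e : ∑ k ∈ Finset.Icc 3 n, 2 * step t k * S k =
      2 * ((∑ k ∈ Finset.Icc 3 n, step t k * |startWeight t k|) * ‖p 2‖)
      + 2 * ((∑ k ∈ Finset.Icc 3 n, step t k * |doc t k (k - 3) * kernel t 3 2|) * ‖p 1‖)
      + 2 * ∑ k ∈ Finset.Icc 3 n, step t k *
          ∑ j ∈ Finset.Icc 3 k, |doc t k (k - j)| * ‖f j‖ := by
    rw [Finset.sum_mul, Finset.sum_mul, Finset.mul_sum, Finset.mul_sum, Finset.mul_sum,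
      ← Finset.sum_add_distrib, ← Finset.sum_add_distrib]
    exact Finset.sum_congr rfl fun k _ => by simp only [hS]; ring
  simp only [e]
  have c1 := mul_le_mul_of_nonneg_right b1 (norm_nonneg (p 2))
  have c2 := mul_le_mul_of_nonneg_right b2 (norm_nonneg (p 1))
  linarith

end

theorem sum_step_mul_doc_le {E : Type*} [NormedAddCommGroup E] {t : ℕ → ℝ} {N : ℕ}
    (ht : IsTimeMesh t N) (hr : RatioBound t N) (f : ℕ → E) {n : ℕ} (hn : 3 ≤ n) (hnN : n ≤ N) :
    ∑ k ∈ Finset.Icc 3 n, step t k * ∑ j ∈ Finset.Icc 3 k, |doc t k (k - j)| * ‖f j‖ ≤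
      40 * t n * (Finset.Icc 3 n).sup' (Finset.nonempty_Icc.2 hn) (fun k => ‖f k‖) := by
  set M := (Finset.Icc 3 n).sup' (Finset.nonempty_Icc.2 hn) (fun k => ‖f k‖) with hM
  have hfM : ∀ j ∈ Finset.Icc 3 n, ‖f j‖ ≤ M := fun j hj =>
    Finset.le_sup' (fun k => ‖f k‖) hj
  have hM0 : 0 ≤ M := (norm_nonneg (f 3)).trans (hfM 3 (Finset.mem_Icc.2 ⟨le_rfl, hn⟩))
  have h1 : ∀ k ∈ Finset.Icc 3 n, step t k * ∑ j ∈ Finset.Icc 3 k, |doc t k (k - j)| * ‖f j‖ ≤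
      step t k * (40 * M) := by
    intro k hk
    rw [Finset.mem_Icc] at hk
    refine mul_le_mul_of_nonneg_left ?_ (ht.step_pos (by omega) (by omega)).le
    calc ∑ j ∈ Finset.Icc 3 k, |doc t k (k - j)| * ‖f j‖
        ≤ ∑ j ∈ Finset.Icc 3 k, |doc t k (k - j)| * M := by
          refine Finset.sum_le_sum fun j hj => mul_le_mul_of_nonneg_left (hfM j ?_) (abs_nonneg _)
          rw [Finset.mem_Icc] at hj ⊢
          omega
      _ ≤ 40 * M := by
          rw [← Finset.sum_mul]
          exact mul_le_mul_of_nonneg_right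
            ((hr.sum_abs_doc_row_le (hk.2.trans hnN)).trans (by norm_num)) hM0
  have h2 : ∀ m, 2 ≤ m → m ≤ N → ∑ k ∈ Finset.Icc 3 m, step t k = t m - t 2 := by
    intro m hm
    induction m, hm using Nat.le_induction with
    | base => simp
    | succ m hm ih =>
      intro h
      rw [Finset.sum_Icc_succ_top (by omega), ih (by omega), step, Nat.add_sub_cancel]
      ring
  have h3 : 0 ≤ t 2 := by
    have h4 := ht.1
    have h5 := ht.2 0 (by omega)
    have h6 := ht.2 1 (by omega)
    simp only [zero_add, Nat.reduceAdd] at h5 h6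
    linarith
  refine (Finset.sum_le_sum h1).trans ?_
  rw [← Finset.sum_mul, h2 n (by omega) hnN]
  nlinarith

/-! ### The variational formulation tested with `H¹₀` functions -/

section

variable {d : ℕ} {Ω : Set (EuclideanSpace ℝ (Fin d))}

theorem IsTest.memLp {φ : EuclideanSpace ℝ (Fin d) → ℝ} (h : IsTest Ω φ) :
    MemLp φ 2 (volume.restrict Ω) :=
  h.1.continuous.memLp_of_hasCompactSupport h.2.1

theorem IsTest.memLp_gradient {φ : EuclideanSpace ℝ (Fin d) → ℝ} (h : IsTest Ω φ) :
    MemLp (gradient φ) 2 (volume.restrict Ω) := by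
  have hc : Continuous (gradient φ) :=
    (InnerProductSpace.toDual ℝ _).symm.continuous.comp (h.1.continuous_fderiv (by simp))
  have hs : HasCompactSupport (gradient φ) :=
    (h.2.1.fderiv (𝕜 := ℝ)).comp_left (g := (InnerProductSpace.toDual ℝ _).symm) (map_zero _)
  exact hc.memLp_of_hasCompactSupport hs

theorem HasH10Gradient.exists_tendsto {u : L2 Ω} {g : L2Vec Ω} (h : HasH10Gradient u g) :
    ∃ φ : ℕ → EuclideanSpace ℝ (Fin d) → ℝ, ∃ hφ : ∀ m, IsTest Ω (φ m),
      Tendsto (fun m => (hφ m).memLp.toLp (φ m)) atTop (𝓝 u) ∧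
      Tendsto (fun m => (hφ m).memLp_gradient.toLp (gradient (φ m))) atTop (𝓝 g) := by
  obtain ⟨-, φ, hφ, h1, h2⟩ := h
  refine ⟨φ, hφ, ?_, ?_⟩
  · rw [← Lp.toLp_coeFn u (Lp.memLp u), Lp.tendsto_Lp_iff_tendsto_eLpNorm'']
    exact h1
  · rw [← Lp.toLp_coeFn g (Lp.memLp g), Lp.tendsto_Lp_iff_tendsto_eLpNorm'']
    exact h2

theorem inner_toLp {F : Type*} [NormedAddCommGroup F] [InnerProductSpace ℝ F]
    {μ : Measure (EuclideanSpace ℝ (Fin d))} (u : Lp F 2 μ)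
    {φ : EuclideanSpace ℝ (Fin d) → F} (h : MemLp φ 2 μ) :
    inner ℝ u (h.toLp φ) = ∫ x, inner ℝ (u x) (φ x) ∂μ := by
  rw [L2.inner_def]
  refine integral_congr_ae ?_
  filter_upwards [h.coeFn_toLp] with x hx
  rw [hx]

theorem memLp_mul_of_bound {μ : Measure (EuclideanSpace ℝ (Fin d))}
    {κ : EuclideanSpace ℝ (Fin d) → ℝ} {C : ℝ} (hκ : AEStronglyMeasurable κ μ)
    (hC : ∀ᵐ x ∂μ, |κ x| ≤ C) (u : Lp ℝ 2 μ) : MemLp (fun x => κ x * u x) 2 μ :=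
  (Lp.memLp u).mul (memLp_top_of_bound hκ C hC)

/-- The weak form of `w = ε Δu + κ u + f` may be tested with elements of `H¹₀`. -/
theorem inner_eq_of_weak {ε : ℝ} {κ : EuclideanSpace ℝ (Fin d) → ℝ} {w u f : L2 Ω}
    {g : L2Vec Ω} (hκu : MemLp (fun x => κ x * u x) 2 (volume.restrict Ω))
    (h : ∀ φ, IsTest Ω φ → ∫ x in Ω, w x * φ x =
      -(ε * ∫ x in Ω, inner ℝ (g x) (gradient φ x)) + ∫ x in Ω, (κ x * u x + f x) * φ x)
    {v : L2 Ω} {G : L2Vec Ω} (hv : HasH10Gradient v G) :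
    inner ℝ w v = -(ε * inner ℝ g G) + inner ℝ (hκu.toLp _) v + inner ℝ f v := by
  obtain ⟨φ, hφ, h1, h2⟩ := hv.exists_tendsto
  have hL : Tendsto (fun m => inner ℝ w ((hφ m).memLp.toLp (φ m))) atTop (𝓝 (inner ℝ w v)) :=
    tendsto_const_nhds.inner h1
  have hR : Tendsto (fun m => -(ε * inner ℝ g ((hφ m).memLp_gradient.toLp (gradient (φ m))))
      + inner ℝ (hκu.toLp _) ((hφ m).memLp.toLp (φ m))
      + inner ℝ f ((hφ m).memLp.toLp (φ m))) atTop
      (𝓝 (-(ε * inner ℝ g G) + inner ℝ (hκu.toLp _) v + inner ℝ f v)) :=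
    (((tendsto_const_nhds.inner h2).const_mul ε).neg.add (tendsto_const_nhds.inner h1)).add
      (tendsto_const_nhds.inner h1)
  refine tendsto_nhds_unique hL (hR.congr fun m => ?_)
  have hm := h (φ m) (hφ m)
  rw [add_assoc, ← inner_add_left, inner_toLp, inner_toLp, inner_toLp]
  have e1 : ∫ x in Ω, inner ℝ (w x) (φ m x) = ∫ x in Ω, w x * φ m x :=
    integral_congr_ae (Eventually.of_forall fun x => by simp [mul_comm])
  have e2 : ∫ x in Ω, inner ℝ ((hκu.toLp _ + f : L2 Ω) x) (φ m x) =
      ∫ x in Ω, (κ x * u x + f x) * φ m x := by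
    refine integral_congr_ae ?_
    filter_upwards [Lp.coeFn_add (hκu.toLp _) f, hκu.coeFn_toLp] with x hx hx'
    rw [hx, Pi.add_apply, hx']
    simp [mul_comm]
  rw [e1, e2, hm]

/-- Multiplication by `κ = -(√(-κ))²` as a nonpositive form. -/
theorem inner_mul_eq_neg_inner_sqrt {μ : Measure (EuclideanSpace ℝ (Fin d))}
    {κ : EuclideanSpace ℝ (Fin d) → ℝ} (hκ : ∀ᵐ x ∂μ, κ x ≤ 0) {u v : Lp ℝ 2 μ}
    (hu : MemLp (fun x => κ x * u x) 2 μ) (hu' : MemLp (fun x => √(-κ x) * u x) 2 μ)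
    (hv' : MemLp (fun x => √(-κ x) * v x) 2 μ) :
    inner ℝ (hu.toLp _) v = -inner ℝ (hu'.toLp _) (hv'.toLp _) := by
  rw [L2.inner_def, L2.inner_def, ← integral_neg]
  refine integral_congr_ae ?_
  filter_upwards [hκ, hu.coeFn_toLp, hu'.coeFn_toLp, hv'.coeFn_toLp] with x h0 h1 h2 h3
  rw [h1, h2, h3]
  have h4 := Real.mul_self_sqrt (neg_nonneg.2 h0)
  simp only [RCLike.inner_apply, conj_trivial]
  linear_combination u x * v x * h4

theorem IsSolution.norm_le (hΩ : IsOpen Ω) {ε : ℝ} (hε : 0 < ε)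
    {κ : EuclideanSpace ℝ (Fin d) → ℝ} {C : ℝ} (hκ : ContinuousOn κ Ω)
    (hC : ∀ x ∈ Ω, |κ x| ≤ C) (hκ0 : ∀ x ∈ Ω, κ x < 0) {N : ℕ} (hN : 1 ≤ N) {t : ℕ → ℝ}
    (ht : IsTimeMesh t N) (hr : RatioBound t N) {f u : ℕ → L2 Ω}
    (hu : IsSolution ε κ t N f u) {n : ℕ} (hn : 3 ≤ n) (hnN : n ≤ N) :
    ‖u n‖ ≤ ‖u 2‖ + 40 * maxStep t N hN * ‖diffQuot t u 1‖
      + 4 * 40 * maxStep t N hN * ‖diffQuot t u 2‖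
      + 2 * ∑ k ∈ Finset.Icc 3 n, step t k *
          ∑ j ∈ Finset.Icc 3 k, |doc t k (k - j)| * ‖f j‖ := by
  have hm := hκ.aestronglyMeasurable (μ := volume) hΩ.measurableSet
  have h1 : ∀ᵐ x ∂volume.restrict Ω, |κ x| ≤ C := ae_restrict_of_forall_mem hΩ.measurableSet hC
  have h2 : ∀ᵐ x ∂volume.restrict Ω, |√(-κ x)| ≤ √C :=
    ae_restrict_of_forall_mem hΩ.measurableSet fun x hx => by
      rw [abs_of_nonneg (Real.sqrt_nonneg _)]
      exact Real.sqrt_le_sqrt ((neg_le_abs _).trans (hC x hx))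
  have hm2 : AEStronglyMeasurable (fun x => √(-κ x)) (volume.restrict Ω) :=
    Real.continuous_sqrt.comp_aestronglyMeasurable hm.neg
  have h3 : ∀ᵐ x ∂volume.restrict Ω, κ x ≤ 0 :=
    ae_restrict_of_forall_mem hΩ.measurableSet fun x hx => (hκ0 x hx).le
  choose! g hg hw using hu
  refine norm_le_of_inner_scheme hN ht hr hε.le (g := g)
    (q := fun k => (memLp_mul_of_bound hm2 h2 (u k)).toLp _) (fun j k hj hjN hk hkN => ?_) hn hnN
  rw [inner_eq_of_weak (memLp_mul_of_bound hm h1 (u j)) (hw j hj hjN) (hg k hk hkN),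
    inner_mul_eq_neg_inner_sqrt h3 _ (memLp_mul_of_bound hm2 h2 (u j))
      (memLp_mul_of_bound hm2 h2 (u k))]
  rfl

end

end BDF3

end

theorem mainTheorem4 :
    ∃ K₃ : ℝ, 0 < K₃ ∧
      -- `K₃` bounds the absolute row and column sums of the DOC kernels, uniformly in the mesh
      (∀ (N : ℕ) (t : ℕ → ℝ), BDF3.IsTimeMesh t N →
        (∀ k, 2 ≤ k → k ≤ N → 0 < BDF3.ratio t k ∧ BDF3.ratio t k ≤ BDF3.Re) →
        ∀ n, 3 ≤ n → n ≤ N →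
          ∑ j ∈ Finset.Icc 3 n, |BDF3.doc t n (n - j)| ≤ K₃ ∧
          ∀ i, 3 ≤ i → ∑ j ∈ Finset.Icc i n, |BDF3.doc t j (j - i)| ≤ K₃) ∧
      -- the stability estimates
      ∀ (d : ℕ) (Ω : Set (EuclideanSpace ℝ (Fin d))),
        IsOpen Ω → Bornology.IsBounded Ω → Convex ℝ Ω →
      ∀ (ε : ℝ), 0 < ε →
      ∀ (κ : EuclideanSpace ℝ (Fin d) → ℝ) (κs : ℝ), ContDiffOn ℝ ∞ κ Ω →
        (∀ x ∈ Ω, |κ x| ≤ κs) → (∀ x ∈ Ω, κ x < 0) →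
      ∀ (N : ℕ) (hN : 1 ≤ N) (t : ℕ → ℝ), BDF3.IsTimeMesh t N →
        (∀ k, 2 ≤ k → k ≤ N → 0 < BDF3.ratio t k ∧ BDF3.ratio t k < BDF3.Re) →
      ∀ (f u : ℕ → BDF3.L2 Ω), BDF3.IsSolution ε κ t N f u →
      ∀ (n : ℕ) (hn : 3 ≤ n), n ≤ N →
        ‖u n‖ ≤ ‖u 2‖ + K₃ * BDF3.maxStep t N hN * ‖BDF3.diffQuot t u 1‖
            + 4 * K₃ * BDF3.maxStep t N hN * ‖BDF3.diffQuot t u 2‖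
            + 2 * ∑ k ∈ Finset.Icc 3 n, BDF3.step t k *
                ∑ j ∈ Finset.Icc 3 k, |BDF3.doc t k (k - j)| * ‖f j‖ ∧
        ‖u 2‖ + K₃ * BDF3.maxStep t N hN * ‖BDF3.diffQuot t u 1‖
            + 4 * K₃ * BDF3.maxStep t N hN * ‖BDF3.diffQuot t u 2‖
            + 2 * ∑ k ∈ Finset.Icc 3 n, BDF3.step t k *
                ∑ j ∈ Finset.Icc 3 k, |BDF3.doc t k (k - j)| * ‖f j‖
          ≤ ‖u 2‖ + K₃ * BDF3.maxStep t N hN * ‖BDF3.diffQuot t u 1‖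
            + 4 * K₃ * BDF3.maxStep t N hN * ‖BDF3.diffQuot t u 2‖
            + 2 * K₃ * t n *
                (Finset.Icc 3 n).sup' (Finset.nonempty_Icc.2 hn) (fun k => ‖f k‖) := by
  have hbound : ∀ (N : ℕ) (t : ℕ → ℝ),
      (∀ k, 2 ≤ k → k ≤ N → 0 < BDF3.ratio t k ∧ BDF3.ratio t k ≤ BDF3.Re) →
      BDF3.RatioBound t N := fun N t h k h1 h2 =>
    ⟨(h k h1 h2).1, (h k h1 h2).2.trans BDF3.Re_lt.le⟩
  -- The constant `40` covers the kernel sums `22` and, after the factor `2` from testing, the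
  -- starting weights: `2 * 20 = 40` and `2 * 80 = 4 * 40`.
  refine ⟨40, by norm_num, fun N t _ hr n _ hnN => ⟨?_, fun i hi => ?_⟩, ?_⟩
  · exact ((hbound N t hr).sum_abs_doc_row_le hnN).trans (by norm_num)
  · exact ((hbound N t hr).sum_abs_doc_column_le hnN hi).trans (by norm_num)
  · intro d Ω hΩ _ _ ε hε κ κs hκ hκs hκ0 N hN t ht hr f u hu n hn hnN
    have hr' := hbound N t fun k h1 h2 => ⟨(hr k h1 h2).1, (hr k h1 h2).2.le⟩
    refine ⟨hu.norm_le hΩ hε hκ.continuousOn hκs hκ0 hN ht hr' hn hnN, ?_⟩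
    linarith [BDF3.sum_step_mul_doc_le ht hr' f hn hnN]
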